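/- Let $\phi=(\phi(x))_{x\in Z}$ be a complex random field indexed by a countable set $Z$, on a probability space $(\Omega,\mathcal M,\mu)$ with expectation $\mathbb E$, closed under complex conjugation: for every $x\in Z$ there is $x_*\in Z$ with $\phi(x)^*=\phi(x_*)$. Let $N\ge 1$ be an integer and let $X\in L^2(\mu)$ be a complex random variable. Notation. For a finite sequence $(y_i)_{i\in I}$ of random variables with $\mathbb E|y^E|<\infty$ for all $E\subseteq I$, where $y^E=\prod_{i\in E}y_i$, the cumulant $\kappa[y_I]$ (for $I\neq\emptyset$) and the Wick polynomial ${:}y^I{:}$ are defined recursively by $$\kappa[y_I]=\mathbb E[y^I]-\sum_{E:\,j\in E\subsetneq I}\mathbb E[y^{I\setminus E}]\,\kappa[y_E],\qquad {:}y^I{:}=y^I-\sum_{E\subsetneq I}\mathbb E[y^{I\setminus E}]\,{:}y^E{:},$$ where $j\in I$ is arbitrary (the result does not depend on it). For $1\le p<\infty$ and $n\ge1$ put $$\|\phi\|^{(n)}_p=\sup_{x_0\in Z}\Bigl[\sum_{x\in Z^{n-1}}|\kappa[\phi(x_0),\phi(x_1),\dots,\phi(x_{n-1})]|^p\Bigr]^{1/p},\qquad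 M_m(\phi;p)=\max_{1\le n\le m}\Bigl(\tfrac1{n!}\|\phi\|^{(n)}_p\Bigr)^{1/n}.$$ The field $\phi$ is called $\ell_p$-clustering up to order $m$ if for all $1\le n\le m$ its cumulants of order $n$ exist (that is, the moments required above are finite) and $\|\phi\|^{(n)}_p<\infty$. Finally, let $\operatorname{cov}(X^*,X)=\mathbb E[X^*X]-\mathbb E[X^*]\,\mathbb E[X]$ and $$\Phi_n(x',x)=\mathbb E\bigl[{:}\phi(x'_1)^*\cdots\phi(x'_n)^*{:}\;{:}\phi(x_1)\cdots\phi(x_n){:}\bigr],\qquad x',x\in Z^n.$$ Claim. 1. If $\phi$ is $\ell_1$-clustering up to order $2N$, then for every $1\le n\le N$ the cumulants $\kappa[X,\phi(x_1),\dots,\phi(x_n)]$ exist for all $x\in Z^n$ and $$\Bigl[\sum_{x\in Z^n}|\kappa[X,\phi(x_1),\dots,\phi(x_n)]|^2\Bigr]^{1/2}\le\sqrt{\operatorname{cov}(X^*,X)}\;M_{2n}(\phi;1)^n\,e^n\,\sqrt{(2n)!}<\infty.$$ 2. If $\phi$ is $\ell_2$-clustering up to order $2N$, then for every $1\le n\le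 N$ the cumulants $\kappa[X,\phi(x_1),\dots,\phi(x_n)]$ and the expectations $\Phi_n(x',x)$ exist for all $x,x'\in Z^n$ and $$\sup_{x'\in Z^n}\Bigl[\sum_{x\in Z^n}|\Phi_n(x',x)|\,|\kappa[X,\phi(x_1),\dots,\phi(x_n)]|^2\Bigr]^{1/2}\le\sqrt{\operatorname{cov}(X^*,X)}\;M_{2n}(\phi;2)^{2n}\,e^{2n}\,(2n)!<\infty.$$ -/

import Mathlib

open MeasureTheory
open scoped ENNReal ComplexConjugate

noncomputable section

namespace RandomField

variable {Ω : Type*} [MeasurableSpace Ω]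

/-- The moment `E[y^I] = E[∏_{i ∈ I} y_i]` of a family of complex random variables. The labels `i`
are distinct, the random variables `y i` may be repeated. -/
def moment {ι : Type*} (μ : Measure Ω) (y : ι → Ω → ℂ) (I : Finset ι) : ℂ :=
  ∫ ω, ∏ i ∈ I, y i ω ∂μ

/-- The condition under which the cumulant and the Wick polynomial of `(y_i)_{i ∈ I}` are defined:
`E[|y^E|] < ∞` for all `E ⊆ I`. -/
def MomentsExist {ι : Type*} (μ : Measure Ω) (y : ι → Ω → ℂ) (I : Finset ι) : Prop :=
  ∀ E ⊆ I, Integrable (fun ω => ∏ i ∈ E, y i ω) μ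

/-- The Wick polynomial `:y^I:`, defined recursively by
`:y^I: = y^I - ∑_{E ⊊ I} E[y^{I \ E}] :y^E:`. -/
def wick {ι : Type*} [DecidableEq ι] (μ : Measure Ω) (y : ι → Ω → ℂ) (I : Finset ι) (ω : Ω) : ℂ :=
  ∏ i ∈ I, y i ω - ∑ E ∈ I.ssubsets.attach, moment μ y (I \ E.1) * wick μ y E.1 ω
termination_by I.card
decreasing_by exact Finset.card_lt_card (Finset.mem_ssubsets.1 E.2)

/-- The joint cumulant `κ[y_I]`, defined recursively by
`κ[y_I] = E[y^I] - ∑_{E : j ∈ E ⊊ I} E[y^{I \ E}] κ[y_E]`, where `j` is an element of `I`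
(the value does not depend on which one; the smallest label is used here). The value at `I = ∅` is
a convention. -/
def cumulant {ι : Type*} [LinearOrder ι] (μ : Measure Ω) (y : ι → Ω → ℂ) (I : Finset ι) : ℂ :=
  if h : I.Nonempty then
    moment μ y I - ∑ E ∈ (I.ssubsets.filter (fun E => I.min' h ∈ E)).attach,
      moment μ y (I \ E.1) * cumulant μ y E.1
  else 0
termination_by I.card
decreasing_by
  exact Finset.card_lt_card (Finset.mem_ssubsets.1 (Finset.mem_filter.1 E.2).1)

/-- The defining recursion of the Wick polynomials. -/
theorem wick_eq {ι : Type*} [DecidableEq ι] (μ : Measure Ω) (y : ι → Ω → ℂ) (I : Finset ι)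
    (ω : Ω) :
    wick μ y I ω =
      ∏ i ∈ I, y i ω - ∑ E ∈ I.ssubsets, moment μ y (I \ E) * wick μ y E ω := by
  rw [wick, Finset.sum_attach I.ssubsets (fun E => moment μ y (I \ E) * wick μ y E ω)]

/-- The defining recursion of the cumulants. -/
theorem cumulant_eq {ι : Type*} [LinearOrder ι] (μ : Measure Ω) (y : ι → Ω → ℂ) (I : Finset ι)
    (h : I.Nonempty) :
    cumulant μ y I =
      moment μ y I - ∑ E ∈ I.ssubsets.filter (fun E => I.min' h ∈ E),
        moment μ y (I \ E) * cumulant μ y E := by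
  rw [cumulant, dif_pos h, Finset.sum_attach (I.ssubsets.filter (fun E => I.min' h ∈ E))
    (fun E => moment μ y (I \ E) * cumulant μ y E)]

/-- `κ[y_1, …, y_n]`, the cumulant of a finite sequence of random variables. -/
def kappa (μ : Measure Ω) {n : ℕ} (y : Fin n → Ω → ℂ) : ℂ :=
  cumulant μ y Finset.univ

/-- The covariance `cov(Y, X) = E[Y X] - E[Y] E[X]`, bilinear (no complex conjugation). -/
def cov (μ : Measure Ω) (Y X : Ω → ℂ) : ℂ :=
  ∫ ω, Y ω * X ω ∂μ - (∫ ω, Y ω ∂μ) * ∫ ω, X ω ∂μ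

variable {Z : Type*}

/-- The field `φ` is closed under complex conjugation: for every `x` there is `x_*` with
`φ(x)^* = φ(x_*)` almost surely. -/
def ClosedUnderConj (μ : Measure Ω) (φ : Z → Ω → ℂ) : Prop :=
  ∀ x, ∃ x', (fun ω => conj (φ x ω)) =ᵐ[μ] φ x'

/-- The clustering norm, for `n ≥ 1`,
`‖φ‖_p^{(n)} = sup_{x_0} (∑_{x ∈ Z^{n-1}} |κ[φ(x_0), φ(x_1), …, φ(x_{n-1})]|^p)^{1/p}`. -/
def clusteringNorm (μ : Measure Ω) (φ : Z → Ω → ℂ) (p : ℝ) : ℕ → ℝ≥0∞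
  | 0 => 0
  | n + 1 => ⨆ x₀ : Z, (∑' x : Fin n → Z,
      ‖kappa μ (fun i => φ (Matrix.vecCons x₀ x i))‖ₑ ^ p) ^ (1 / p)

/-- `φ` is `ℓ_p`-clustering up to order `m`: the cumulants of `φ` of all orders `n ≤ m` exist and
the corresponding clustering norms are finite. -/
def IsClusteringUpTo (μ : Measure Ω) (φ : Z → Ω → ℂ) (p : ℝ) (m : ℕ) : Prop :=
  ∀ n, 1 ≤ n → n ≤ m →
    (∀ x : Fin n → Z, MomentsExist μ (fun i => φ (x i)) Finset.univ) ∧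
      clusteringNorm μ φ p n < ∞

/-- `M_N(φ; p) = max_{1 ≤ n ≤ N} (‖φ‖_p^{(n)} / n!)^{1/n}`, a real number when `φ` is
`ℓ_p`-clustering up to order `N`. -/
def clusteringConst (μ : Measure Ω) (φ : Z → Ω → ℂ) (p : ℝ) (N : ℕ) : ℝ :=
  ((Finset.Icc 1 N).sup
    (fun n => (clusteringNorm μ φ p n / (n.factorial : ℝ≥0∞)) ^ (1 / (n : ℝ)))).toReal

/-- The Wick polynomial `:φ(x_1) ⋯ φ(x_n):`. -/
def wickField (μ : Measure Ω) (φ : Z → Ω → ℂ) {n : ℕ} (x : Fin n → Z) (ω : Ω) : ℂ :=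
  wick μ (fun i => φ (x i)) Finset.univ ω

/-- The Wick polynomial `:φ(x_1)^* ⋯ φ(x_n)^*:`. -/
def wickFieldConj (μ : Measure Ω) (φ : Z → Ω → ℂ) {n : ℕ} (x : Fin n → Z) (ω : Ω) : ℂ :=
  wick μ (fun i ω' => conj (φ (x i) ω')) Finset.univ ω

/-- `Φ_n(x', x) = E[:φ(x'_1)^* ⋯ φ(x'_n)^*: :φ(x_1) ⋯ φ(x_n):]`. -/
def wickCov (μ : Measure Ω) (φ : Z → Ω → ℂ) {n : ℕ} (x' x : Fin n → Z) : ℂ :=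
  ∫ ω, wickFieldConj μ φ x' ω * wickField μ φ x ω ∂μ

/-- The sequence of random variables `X, φ(x_1), …, φ(x_n)`. -/
def joint (X : Ω → ℂ) (φ : Z → Ω → ℂ) {n : ℕ} (x : Fin n → Z) : Fin (n + 1) → Ω → ℂ :=
  Matrix.vecCons X (fun i => φ (x i))

end RandomField

end

open RandomField

/-!
# Summability of the cumulants of a random variable with a clustering field

The cumulant `κ[X, φ(x_1), …, φ(x_n)]` equals `E[X :φ(x_1) ⋯ φ(x_n):]`, and `X` may be replaced by
`X - E[X]` because Wick polynomials of positive degree have mean zero (`kappa_joint_eq`). So the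
cumulants are the coefficients of the centred `X`, whose squared `L²` norm is `cov(X^*, X)`, along
the Wick polynomials, and `Φ_n` is the Gram matrix of the latter. For a nonnegative weight `a` the
Bessel inequality
`∑_x a(x) |⟪u, v_x⟫|² ≤ ‖u‖² sup_{x'} ∑_x a(x) |⟪v_{x'}, v_x⟫|` (`tsum_mul_enorm_inner_sq_le`)
gives both claims once the rows of `Φ_n` are bounded by `M^{2n} e^{2n} (2n)!` in `ℓ_p`: for `p = 1`
take `a = 1`, and for `p = 2` take `a = |Φ_n(x', ·)|` and apply the Cauchy-Schwarz inequality to the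
row sums.

The rows of `Φ_n` are bounded through the moment-cumulant recursion (`euler_wickCross`): `Φ_n` is a
sum over the set partitions whose blocks all meet both groups of labels. Fixing the labels of the
first group thus fixes at least one label of each block, and the `ℓ_p` norm of the cumulant of a
block `A` over its other labels is at most `‖φ‖_p^{(|A|)} ≤ |A|! M^{|A|}`. Removing one block
at a time, Minkowski's inequality and `sum_factorial_mul_factorial_le` give the bound
(`tsumNorm_wickCross_le`).

The recursions for moments, cumulants and Wick polynomials are identities in the ring
`SetFunction ι R` of set functions under subset convolution: with the moments `m`, the cumulants
`κ` and the Wick polynomials `w`, they read `w * m = y` and `D κ * m = D m` for the Euler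
derivations `D`.
-/

/-! ### The ring of set functions under subset convolution -/

/-- Functions on the finite subsets of `ι`, with pointwise addition and with the subset convolution
`(f * g) I = ∑_{E ⊆ I} f E * g (I \ E)` as multiplication: the algebra of power series in commuting
variables `(ε_i)_{i ∈ ι}` with `ε_i ^ 2 = 0`. -/
def SetFunction (ι R : Type*) := Finset ι → R

namespace SetFunction

variable {ι κ R : Type*}

@[ext] theorem ext {f g : SetFunction ι R} (h : ∀ I, f I = g I) : f = g := funext h

/-- The pullback of a set function along an injective relabelling. -/
def pullback (e : κ ↪ ι) (f : SetFunction ι R) : SetFunction κ R := fun I => f (I.map e)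

theorem pullback_apply (e : κ ↪ ι) (f : SetFunction ι R) (I : Finset κ) :
    pullback e f I = f (I.map e) := rfl

section CommRing

variable [CommRing R]

instance : AddCommGroup (SetFunction ι R) := inferInstanceAs (AddCommGroup (Finset ι → R))

@[simp] theorem add_apply (f g : SetFunction ι R) (I : Finset ι) : (f + g) I = f I + g I := rfl

@[simp] theorem sub_apply (f g : SetFunction ι R) (I : Finset ι) : (f - g) I = f I - g I := rfl

@[simp] theorem zero_apply (I : Finset ι) : (0 : SetFunction ι R) I = 0 := rfl

variable [DecidableEq ι]

instance : Mul (SetFunction ι R) := ⟨fun f g I => ∑ E ∈ I.powerset, f E * g (I \ E)⟩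

instance : One (SetFunction ι R) := ⟨fun I => if I = ∅ then 1 else 0⟩

theorem mul_apply (f g : SetFunction ι R) (I : Finset ι) :
    (f * g) I = ∑ E ∈ I.powerset, f E * g (I \ E) := rfl

theorem one_apply (I : Finset ι) : (1 : SetFunction ι R) I = if I = ∅ then 1 else 0 := rfl

theorem mul_empty (f g : SetFunction ι R) : (f * g) ∅ = f ∅ * g ∅ := by
  simp [mul_apply]

protected theorem mul_comm (f g : SetFunction ι R) : f * g = g * f := by
  ext I
  rw [mul_apply, mul_apply]
  refine Finset.sum_nbij' (fun E => I \ E) (fun E => I \ E) ?_ ?_ ?_ ?_ ?_ <;>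
    intro E hE <;> rw [Finset.mem_powerset] at hE <;>
    simp [hE, mul_comm]

protected theorem mul_assoc (f g h : SetFunction ι R) : f * g * h = f * (g * h) := by
  ext I
  simp only [mul_apply, Finset.sum_mul, Finset.mul_sum]
  rw [Finset.sum_sigma', Finset.sum_sigma']
  refine Finset.sum_nbij' (fun a => ⟨a.2, a.1 \ a.2⟩) (fun a => ⟨a.1 ∪ a.2, a.1⟩) ?_ ?_ ?_ ?_ ?_
  · rintro ⟨E, F⟩ h
    simp only [Finset.mem_sigma, Finset.mem_powerset] at h ⊢
    exact ⟨h.2.trans h.1, Finset.sdiff_subset_sdiff h.1 le_rfl⟩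
  · rintro ⟨E, F⟩ h
    simp only [Finset.mem_sigma, Finset.mem_powerset] at h ⊢
    exact ⟨Finset.union_subset h.1 (h.2.trans Finset.sdiff_subset), Finset.subset_union_left⟩
  · rintro ⟨E, F⟩ h
    simp only [Finset.mem_sigma, Finset.mem_powerset] at h ⊢
    rw [Finset.union_sdiff_of_subset h.2]
  · rintro ⟨E, F⟩ h
    simp only [Finset.mem_sigma, Finset.mem_powerset] at h ⊢
    have : (E ∪ F) \ E = F := by grind
    rw [this]
  · rintro ⟨E, F⟩ h
    simp only [Finset.mem_sigma, Finset.mem_powerset] at h ⊢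
    have : (I \ F) \ (E \ F) = I \ E := by grind
    rw [this, mul_assoc]

protected theorem one_mul (f : SetFunction ι R) : 1 * f = f := by
  ext I
  rw [mul_apply, Finset.sum_eq_single ∅]
  · simp [one_apply]
  · intro E _ hE
    simp [one_apply, hE]
  · simp

protected theorem mul_add (f g h : SetFunction ι R) : f * (g + h) = f * g + f * h := by
  ext I
  simp [mul_apply, mul_add, Finset.sum_add_distrib]

instance : CommRing (SetFunction ι R) where
  __ := (inferInstance : AddCommGroup (SetFunction ι R))
  mul_assoc := SetFunction.mul_assoc
  mul_comm := SetFunction.mul_comm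
  one_mul := SetFunction.one_mul
  mul_one f := by rw [SetFunction.mul_comm, SetFunction.one_mul]
  left_distrib := SetFunction.mul_add
  right_distrib f g h := by
    rw [SetFunction.mul_comm, SetFunction.mul_add, SetFunction.mul_comm h, SetFunction.mul_comm h]
  zero_mul f := by ext I; simp [mul_apply]
  mul_zero f := by ext I; simp [mul_apply]

/-- A set function vanishing at `∅` is nilpotent when there are finitely many labels, as its `k`-th
power vanishes on the sets with fewer than `k` elements. -/
theorem isNilpotent_of_empty [Fintype ι] {f : SetFunction ι R} (hf : f ∅ = 0) :
    IsNilpotent f := by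
  have key : ∀ (k : ℕ) (I : Finset ι), I.card < k → (f ^ k) I = 0 := by
    intro k
    induction k with
    | zero => intro I h; omega
    | succ k ih =>
      intro I h
      rw [pow_succ', mul_apply]
      refine Finset.sum_eq_zero fun E hE => ?_
      rw [Finset.mem_powerset] at hE
      rcases Finset.eq_empty_or_nonempty E with rfl | hne
      · rw [hf, zero_mul]
      · rw [ih, mul_zero]
        have := Finset.card_sdiff_of_subset hE
        have := hne.card_pos
        have := Finset.card_le_card hE
        omega
  refine ⟨Fintype.card ι + 1, ?_⟩
  ext I
  exact key _ I (Nat.lt_succ_of_le (Finset.card_le_univ I))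

theorem isUnit_of_empty [Fintype ι] {f : SetFunction ι R} (hf : f ∅ = 1) : IsUnit f := by
  have h := (isNilpotent_of_empty (f := 1 - f) (by simp [one_apply, hf])).isUnit_one_sub
  simpa using h

/-- Changing the second factor only at `I` does not affect `(f * g) I` when `f ∅ = 0`. -/
theorem mul_apply_congr_right {f g g' : SetFunction ι R} {I : Finset ι} (hf : f ∅ = 0)
    (h : ∀ E, E ⊂ I → g E = g' E) : (f * g) I = (f * g') I := by
  refine Finset.sum_congr rfl fun E hE => ?_
  rw [Finset.mem_powerset] at hE
  rcases Finset.eq_empty_or_nonempty E with rfl | hne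
  · rw [hf, zero_mul, zero_mul]
  · rw [h _ (Finset.sdiff_ssubset hE hne)]

/-- The Euler operator `ε_j ∂/∂ε_j`: it keeps the values at the sets that contain `j`. -/
def euler (j : ι) (f : SetFunction ι R) : SetFunction ι R := fun I => if j ∈ I then f I else 0

theorem euler_apply (j : ι) (f : SetFunction ι R) (I : Finset ι) :
    euler j f I = if j ∈ I then f I else 0 := rfl

theorem euler_mul (j : ι) (f g : SetFunction ι R) :
    euler j (f * g) = euler j f * g + f * euler j g := by
  ext I
  simp only [euler_apply, add_apply, mul_apply, ← Finset.sum_add_distrib]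
  by_cases hj : j ∈ I
  · rw [if_pos hj]
    refine Finset.sum_congr rfl fun E _ => ?_
    by_cases hE : j ∈ E <;> simp [hj, hE]
  · rw [if_neg hj]
    symm
    refine Finset.sum_eq_zero fun E hE => ?_
    rw [Finset.mem_powerset] at hE
    have : j ∉ E := fun h => hj (hE h)
    simp [hj, this]

theorem euler_sub (j : ι) (f g : SetFunction ι R) : euler j (f - g) = euler j f - euler j g := by
  ext I
  by_cases hj : j ∈ I <;> simp [euler_apply, hj]

theorem euler_comm (j k : ι) (f : SetFunction ι R) : euler j (euler k f) = euler k (euler j f) := by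
  ext I
  by_cases hj : j ∈ I <;> simp [euler_apply, hj]

/-- The restriction of a set function to the subsets of `P`: the variables outside `P` are set to
zero. -/
def restrict (P : Finset ι) (f : SetFunction ι R) : SetFunction ι R :=
  fun I => if I ⊆ P then f I else 0

theorem restrict_apply (P : Finset ι) (f : SetFunction ι R) (I : Finset ι) :
    restrict P f I = if I ⊆ P then f I else 0 := rfl

theorem restrict_mul (P : Finset ι) (f g : SetFunction ι R) :
    restrict P (f * g) = restrict P f * restrict P g := by
  ext I
  simp only [restrict_apply, mul_apply]
  by_cases hI : I ⊆ P
  · rw [if_pos hI]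
    refine Finset.sum_congr rfl fun E hE => ?_
    rw [Finset.mem_powerset] at hE
    rw [if_pos (hE.trans hI), if_pos (Finset.sdiff_subset.trans hI)]
  · rw [if_neg hI]
    symm
    refine Finset.sum_eq_zero fun E hE => ?_
    rw [Finset.mem_powerset] at hE
    by_cases h1 : E ⊆ P
    · rw [if_neg (c := I \ E ⊆ P), mul_zero]
      intro h2
      exact hI (by rw [← Finset.union_sdiff_of_subset hE]; exact Finset.union_subset h1 h2)
    · rw [if_neg h1, zero_mul]

theorem euler_restrict (j : ι) (P : Finset ι) (f : SetFunction ι R) :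
    euler j (restrict P f) = restrict P (euler j f) := by
  ext I
  by_cases hj : j ∈ I <;> by_cases hI : I ⊆ P <;> simp [euler_apply, restrict_apply, hj, hI]

/-- A product of set functions supported on the subsets of `P` and of its complement has a single
term. -/
theorem restrict_mul_restrict_compl [Fintype ι] (P : Finset ι) (f g : SetFunction ι R)
    (I : Finset ι) : (restrict P f * restrict Pᶜ g) I = f (I ∩ P) * g (I \ P) := by
  rw [mul_apply, Finset.sum_eq_single (I ∩ P)]
  · have h1 : I ∩ P ⊆ P := Finset.inter_subset_right
    have h2 : I \ (I ∩ P) ⊆ Pᶜ := by intro i; simp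
    rw [restrict_apply, restrict_apply, if_pos h1, if_pos h2, Finset.sdiff_inter_self_left]
  · intro E hE hne
    rw [Finset.mem_powerset] at hE
    rw [restrict_apply, restrict_apply]
    by_cases h1 : E ⊆ P
    · rw [if_neg (c := I \ E ⊆ Pᶜ), mul_zero]
      intro h2
      refine hne (Finset.Subset.antisymm (Finset.subset_inter hE h1) fun i hi => ?_)
      by_contra hiE
      have := h2 (Finset.mem_sdiff.2 ⟨(Finset.mem_inter.1 hi).1, hiE⟩)
      exact (Finset.mem_compl.1 this) (Finset.mem_inter.1 hi).2
    · rw [if_neg h1, zero_mul]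
  · intro h
    exact absurd (Finset.mem_powerset.2 Finset.inter_subset_left) h

theorem sum_powerset_map {M : Type*} [AddCommMonoid M] (e : κ ↪ ι) (I : Finset κ)
    (f : Finset ι → M) :
    ∑ E ∈ (I.map e).powerset, f E = ∑ E ∈ I.powerset, f (E.map e) := by
  rw [Finset.map_eq_image, Finset.powerset_image, Finset.sum_image]
  · simp [Finset.map_eq_image]
  · intro E _ F _ h
    exact Finset.image_injective e.injective h

variable [DecidableEq κ]

theorem pullback_mul (e : κ ↪ ι) (f g : SetFunction ι R) :
    pullback e (f * g) = pullback e f * pullback e g := by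
  ext I
  simp only [pullback_apply, mul_apply, sum_powerset_map, Finset.map_sdiff]

theorem pullback_euler (e : κ ↪ ι) (j : κ) (f : SetFunction ι R) :
    pullback e (euler (e j) f) = euler j (pullback e f) := by
  ext I
  simp [pullback_apply, euler_apply]

/-- The derivative with respect to `ε_j`, pulled back along a relabelling that avoids `j`. -/
def derivAt (j : ι) (e : κ ↪ ι) (f : SetFunction ι R) : SetFunction κ R :=
  fun I => f (insert j (I.map e))

theorem derivAt_mul {j : ι} {e : κ ↪ ι} (hj : ∀ i, e i ≠ j) (f g : SetFunction ι R) :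
    derivAt j e (f * g) = derivAt j e f * pullback e g + pullback e f * derivAt j e g := by
  ext I
  have hjI : ∀ E : Finset κ, j ∉ E.map e := by
    intro E h
    obtain ⟨i, _, hi⟩ := Finset.mem_map.1 h
    exact hj i hi
  simp only [derivAt, add_apply, mul_apply, pullback_apply]
  rw [Finset.sum_powerset_insert (hjI I), sum_powerset_map, sum_powerset_map, add_comm]
  congr 1 <;> refine Finset.sum_congr rfl fun E _ => ?_
  · rw [Finset.insert_sdiff_insert, Finset.sdiff_insert_of_notMem (hjI I), Finset.map_sdiff]
  · rw [Finset.insert_sdiff_of_notMem _ (hjI E), Finset.map_sdiff]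

end CommRing

end SetFunction

namespace RandomField

open SetFunction

variable {Ω ι κ : Type*}

/-! ### Moments, cumulants and Wick polynomials as set functions -/

/-- The monomials `y^I` at a sample point, as a set function. -/
def monomialFun (y : ι → Ω → ℂ) (ω : Ω) : SetFunction ι ℂ := fun I => ∏ i ∈ I, y i ω

theorem pullback_monomialFun (e : κ ↪ ι) (y : ι → Ω → ℂ) (ω : Ω) :
    pullback e (monomialFun y ω) = monomialFun (fun i => y (e i)) ω := by
  ext I
  simp [pullback_apply, monomialFun]

variable [MeasurableSpace Ω]

/-- The moments `E[y^I]`, as a set function. -/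
noncomputable def momentFun (μ : Measure Ω) (y : ι → Ω → ℂ) : SetFunction ι ℂ :=
  fun I => moment μ y I

/-- The Wick polynomials `:y^I:` at a sample point, as a set function. -/
noncomputable def wickFun [DecidableEq ι] (μ : Measure Ω) (y : ι → Ω → ℂ) (ω : Ω) :
    SetFunction ι ℂ :=
  fun I => wick μ y I ω

/-- The cumulants `κ[y_I]`, as a set function. -/
noncomputable def cumulantFun [LinearOrder ι] (μ : Measure Ω) (y : ι → Ω → ℂ) : SetFunction ι ℂ :=
  fun I => cumulant μ y I

/-- The entrywise expectation of a random set function. -/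
noncomputable def expect (μ : Measure Ω) (f : Ω → SetFunction ι ℂ) : SetFunction ι ℂ :=
  fun I => ∫ ω, f ω I ∂μ

theorem expect_monomialFun (μ : Measure Ω) (y : ι → Ω → ℂ) :
    expect μ (monomialFun y) = momentFun μ y := rfl

theorem expect_mul [DecidableEq ι] {μ : Measure Ω} {f : Ω → SetFunction ι ℂ}
    (hf : ∀ I, Integrable (fun ω => f ω I) μ) (c : SetFunction ι ℂ) :
    expect μ (fun ω => f ω * c) = expect μ f * c := by
  ext I
  simp only [expect, mul_apply]
  rw [integral_finsetSum _ fun E _ => (hf E).mul_const _]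
  simp only [integral_mul_const]

theorem momentFun_empty (μ : Measure Ω) [IsProbabilityMeasure μ] (y : ι → Ω → ℂ) :
    momentFun μ y ∅ = 1 := by
  simp [momentFun, moment]

theorem isUnit_momentFun [DecidableEq ι] [Fintype ι] (μ : Measure Ω) [IsProbabilityMeasure μ]
    (y : ι → Ω → ℂ) : IsUnit (momentFun μ y) :=
  isUnit_of_empty (momentFun_empty μ y)

theorem MomentsExist.integrable [Fintype ι] {μ : Measure Ω} {y : ι → Ω → ℂ}
    (h : MomentsExist μ y Finset.univ) (I : Finset ι) :
    Integrable (fun ω => monomialFun y ω I) μ :=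
  h I (Finset.subset_univ I)

theorem pullback_momentFun (e : κ ↪ ι) (μ : Measure Ω) (y : ι → Ω → ℂ) :
    pullback e (momentFun μ y) = momentFun μ (fun i => y (e i)) := by
  ext I
  simp [pullback_apply, momentFun, moment]

/-! ### Wick polynomials -/

/-- The recursion of the Wick polynomials says that `w * m = y` for the subset convolution. -/
theorem wickFun_mul_momentFun [DecidableEq ι] (μ : Measure Ω) [IsProbabilityMeasure μ]
    (y : ι → Ω → ℂ) (ω : Ω) : wickFun μ y ω * momentFun μ y = monomialFun y ω := by
  ext I
  have hI : I.powerset = insert I I.ssubsets := by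
    ext E
    simp only [Finset.mem_powerset, Finset.mem_insert, Finset.mem_ssubsets]
    exact le_iff_eq_or_lt
  rw [mul_apply, hI, Finset.sum_insert (by simp), Finset.sdiff_self, momentFun_empty, mul_one]
  simp only [wickFun, momentFun, monomialFun]
  rw [wick_eq]
  simp [mul_comm]

theorem wick_empty [DecidableEq ι] (μ : Measure Ω) (y : ι → Ω → ℂ) (ω : Ω) : wick μ y ∅ ω = 1 := by
  rw [wick_eq, Finset.eq_empty_of_forall_notMem (s := (∅ : Finset ι).ssubsets) (by simp)]
  simp

theorem pullback_wickFun [DecidableEq ι] [DecidableEq κ] [Fintype κ] (e : κ ↪ ι) (μ : Measure Ω)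
    [IsProbabilityMeasure μ] (y : ι → Ω → ℂ) (ω : Ω) :
    pullback e (wickFun μ y ω) = wickFun μ (fun i => y (e i)) ω := by
  refine (isUnit_momentFun μ (fun i => y (e i))).mul_left_injective ?_
  simp only
  rw [wickFun_mul_momentFun, ← pullback_momentFun, ← pullback_mul, wickFun_mul_momentFun,
    pullback_monomialFun]

/-- A Wick polynomial is a linear combination of monomials with deterministic coefficients. -/
theorem exists_wickFun_eq [DecidableEq ι] [Fintype ι] (μ : Measure Ω) [IsProbabilityMeasure μ]
    (y : ι → Ω → ℂ) :
    ∃ c, momentFun μ y * c = 1 ∧ ∀ ω, wickFun μ y ω = monomialFun y ω * c := by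
  obtain ⟨c, hc⟩ := (isUnit_momentFun μ y).exists_right_inv
  refine ⟨c, hc, fun ω => ?_⟩
  rw [← wickFun_mul_momentFun μ y ω, mul_assoc, hc, mul_one]

theorem expect_wickFun [DecidableEq ι] [Fintype ι] {μ : Measure Ω} [IsProbabilityMeasure μ]
    {y : ι → Ω → ℂ} (hy : MomentsExist μ y Finset.univ) : expect μ (wickFun μ y) = 1 := by
  obtain ⟨c, hc, hw⟩ := exists_wickFun_eq μ y
  rw [funext hw, expect_mul hy.integrable, expect_monomialFun, hc]

theorem conj_moment (μ : Measure Ω) (y : ι → Ω → ℂ) (I : Finset ι) :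
    moment μ (fun i ω => conj (y i ω)) I = conj (moment μ y I) := by
  simp only [moment, ← integral_conj, map_prod]

theorem conj_wick [DecidableEq ι] (μ : Measure Ω) (y : ι → Ω → ℂ) (I : Finset ι) (ω : Ω) :
    wick μ (fun i ω => conj (y i ω)) I ω = conj (wick μ y I ω) := by
  induction I using Finset.strongInduction with
  | H I ih =>
    rw [wick_eq, wick_eq μ y, map_sub, map_prod, map_sum]
    congr 1
    refine Finset.sum_congr rfl fun E hE => ?_
    rw [map_mul, conj_moment, ih E (Finset.mem_ssubsets.1 hE)]

theorem moment_congr_ae {μ : Measure Ω} {y z : ι → Ω → ℂ} {I : Finset ι}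
    (h : ∀ i ∈ I, y i =ᵐ[μ] z i) : moment μ y I = moment μ z I := by
  refine integral_congr_ae ?_
  filter_upwards [(Filter.eventually_all_finset I).2 h] with ω hω
  exact Finset.prod_congr rfl hω

theorem wick_congr_ae [DecidableEq ι] {μ : Measure Ω} {y z : ι → Ω → ℂ} {I : Finset ι}
    (h : ∀ i ∈ I, y i =ᵐ[μ] z i) : wick μ y I =ᵐ[μ] wick μ z I := by
  filter_upwards [(Filter.eventually_all_finset I).2 h] with ω hω
  induction I using Finset.strongInduction with
  | H I ih =>
    rw [wick_eq, wick_eq μ z, Finset.prod_congr rfl hω]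
    congr 1
    refine Finset.sum_congr rfl fun E hE => ?_
    have hE' := (Finset.mem_ssubsets.1 hE).1
    rw [moment_congr_ae fun i hi => h i (Finset.sdiff_subset hi),
      ih E (Finset.mem_ssubsets.1 hE) (fun i hi => h i (hE' hi)) fun i hi => hω i (hE' hi)]

/-! ### Cumulants -/

section Cumulants

variable [LinearOrder ι] [LinearOrder κ] {μ : Measure Ω}

theorem cumulantFun_empty (μ : Measure Ω) (y : ι → Ω → ℂ) : cumulantFun μ y ∅ = 0 := by
  rw [cumulantFun, cumulant, dif_neg (by simp)]

theorem cumulant_congr_ae {y z : ι → Ω → ℂ} {I : Finset ι} (h : ∀ i ∈ I, y i =ᵐ[μ] z i) :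
    cumulant μ y I = cumulant μ z I := by
  induction I using Finset.strongInduction with
  | H I ih =>
    rcases I.eq_empty_or_nonempty with rfl | hI
    · rw [cumulant, cumulant, dif_neg (by simp), dif_neg (by simp)]
    · rw [cumulant_eq _ _ _ hI, cumulant_eq _ _ _ hI, moment_congr_ae h]
      congr 1
      refine Finset.sum_congr rfl fun E hE => ?_
      have hE' := Finset.mem_ssubsets.1 (Finset.mem_filter.1 hE).1
      rw [moment_congr_ae fun i hi => h i (Finset.sdiff_subset hi),
        ih E hE' fun i hi => h i (hE'.1 hi)]

variable [IsProbabilityMeasure μ]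

theorem euler_min_cumulantFun_mul (y : ι → Ω → ℂ) {I : Finset ι} (h : I.Nonempty) :
    (euler (I.min' h) (cumulantFun μ y) * momentFun μ y) I = momentFun μ y I := by
  have hI : I.powerset = insert I I.ssubsets := by
    ext E
    simp only [Finset.mem_powerset, Finset.mem_insert, Finset.mem_ssubsets]
    exact le_iff_eq_or_lt
  rw [mul_apply, hI, Finset.sum_insert (by simp), Finset.sdiff_self, momentFun_empty, mul_one]
  simp only [euler_apply, momentFun, cumulantFun]
  rw [if_pos (I.min'_mem h), cumulant_eq μ y I h, Finset.sum_filter]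
  have : ∀ E ∈ I.ssubsets, (if I.min' h ∈ E then cumulant μ y E else 0) * moment μ y (I \ E) =
      if I.min' h ∈ E then moment μ y (I \ E) * cumulant μ y E else 0 := by
    intro E _
    split_ifs <;> ring
  rw [Finset.sum_congr rfl this]
  ring

/-- The recursion of the cumulants holds for every choice of the distinguished label `j`. By
induction on `I`, the convolution `euler j κ * m` may be expanded at a second label `k`, and the
outcome is symmetric in `j` and `k`. -/
theorem euler_cumulantFun_mul (μ : Measure Ω) [IsProbabilityMeasure μ] (y : ι → Ω → ℂ) (j : ι) :
    euler j (cumulantFun μ y) * momentFun μ y = euler j (momentFun μ y) := by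
  set K := cumulantFun μ y
  set m := momentFun μ y
  have key : ∀ (I : Finset ι) (j : ι), (euler j K * m) I = euler j m I := by
    intro I
    induction I using Finset.strongInduction with
    | H I ih =>
      have swap : ∀ j k, k ∈ I → (euler j K * m) I =
          (euler k (euler j K) * m + euler j K * (euler k K * m)) I := by
        intro j k hk
        have h1 : (euler j K * m) I = euler k (euler j K * m) I := by
          rw [euler_apply, if_pos hk]
        rw [h1, euler_mul, SetFunction.add_apply, SetFunction.add_apply]
        congr 1
        refine mul_apply_congr_right (by simp [euler_apply]) fun E hE => ?_
        exact (ih E hE k).symm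
      intro j
      by_cases hj : j ∈ I
      · have hne : I.Nonempty := ⟨j, hj⟩
        rw [euler_apply, if_pos hj, swap j _ (I.min'_mem hne), euler_comm, mul_left_comm,
          ← swap _ j hj]
        exact euler_min_cumulantFun_mul y hne
      · rw [euler_apply, if_neg hj, mul_apply]
        refine Finset.sum_eq_zero fun E hE => ?_
        rw [euler_apply, if_neg fun h => hj (Finset.mem_powerset.1 hE h), zero_mul]
  ext I
  exact key I j

/-- Cumulants do not depend on the labelling of the random variables. -/
theorem pullback_cumulantFun [Fintype κ] (e : κ ↪ ι) (y : ι → Ω → ℂ) :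
    pullback e (cumulantFun μ y) = cumulantFun μ (fun i => y (e i)) := by
  have h : ∀ j, euler j (pullback e (cumulantFun μ y)) =
      euler j (cumulantFun μ (fun i => y (e i))) := by
    intro j
    refine (isUnit_momentFun μ (fun i => y (e i))).mul_left_injective ?_
    simp only
    rw [euler_cumulantFun_mul, ← pullback_momentFun, ← pullback_euler, ← pullback_mul,
      euler_cumulantFun_mul, pullback_euler]
  ext I
  rcases I.eq_empty_or_nonempty with rfl | ⟨j, hj⟩
  · rw [pullback_apply, Finset.map_empty, cumulantFun_empty, cumulantFun_empty]
  · simpa [euler_apply, hj] using congrFun (h j) I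

/-- `κ[y_0, y_1, …, y_n] = E[y_0 :y_1 ⋯ y_n:]`: both sides solve the recursion of the cumulants
with distinguished label `0`. -/
theorem kappa_eq_integral_mul_wick {n : ℕ} (y : Fin (n + 1) → Ω → ℂ)
    (hy : MomentsExist μ y Finset.univ) :
    kappa μ y = ∫ ω, y 0 ω * wick μ (fun i : Fin n => y i.succ) Finset.univ ω ∂μ := by
  set z : Fin n → Ω → ℂ := fun i => y i.succ with hz
  obtain ⟨c, hc, hw⟩ := exists_wickFun_eq μ z
  have h0 : ∀ i, (Fin.succEmb n) i ≠ 0 := fun i => Fin.succ_ne_zero i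
  set f : Ω → SetFunction (Fin n) ℂ := fun ω I => y 0 ω * monomialFun z ω I with hf
  have hfd : ∀ ω I, f ω I = monomialFun y ω (insert 0 (I.map (Fin.succEmb n))) := by
    intro ω I
    simp only [hf, monomialFun]
    rw [Finset.prod_insert]
    · simp [hz]
    · simp
  have hfi : ∀ I, Integrable (fun ω => f ω I) μ := by
    intro I
    simp only [hfd]
    exact hy.integrable _
  have h1 : derivAt 0 (Fin.succEmb n) (momentFun μ y) = expect μ f := by
    ext I
    simp only [derivAt, expect, hfd]
    rfl
  have h2 : derivAt 0 (Fin.succEmb n) (cumulantFun μ y) * momentFun μ z = expect μ f := by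
    have h3 : pullback (Fin.succEmb n) (euler 0 (cumulantFun μ y)) = 0 := by
      ext I
      simp [pullback_apply, euler_apply]
    have h4 : ∀ g : SetFunction (Fin (n + 1)) ℂ, derivAt 0 (Fin.succEmb n) (euler 0 g) =
        derivAt 0 (Fin.succEmb n) g := by
      intro g
      ext I
      simp [derivAt, euler_apply]
    have h5 := congrArg (derivAt 0 (Fin.succEmb n)) (euler_cumulantFun_mul μ y 0)
    rw [derivAt_mul h0, h3, zero_mul, add_zero, h4, h4, h1, pullback_momentFun] at h5
    exact h5
  have h6 : derivAt 0 (Fin.succEmb n) (cumulantFun μ y) =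
      expect μ (fun ω => f ω * c) := by
    rw [expect_mul hfi, ← h2, mul_assoc, hc, mul_one]
  have h7 := congrFun h6 Finset.univ
  have h8 : insert 0 (Finset.univ.map (Fin.succEmb n)) =
      (Finset.univ : Finset (Fin (n + 1))) := by
    ext i
    refine Fin.cases ?_ ?_ i <;> simp
  rw [derivAt, h8] at h7
  rw [kappa]
  refine h7.trans (integral_congr_ae (Filter.Eventually.of_forall fun ω => ?_))
  have h9 := congrFun (hw ω) Finset.univ
  simp only [wickFun] at h9
  simp only
  rw [h9, mul_apply, mul_apply, Finset.mul_sum]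
  exact Finset.sum_congr rfl fun E _ => by simp only [hf]; ring

end Cumulants

/-! ### Expectations of products of two Wick polynomials -/

section Cross

variable [LinearOrder ι] {μ : Measure Ω}

/-- The cumulants of the mixed sets, which meet both `P` and its complement. -/
noncomputable def mixedCumulant (μ : Measure Ω) (y : ι → Ω → ℂ) (P : Finset ι) : SetFunction ι ℂ :=
  fun I => if (I ∩ P).Nonempty ∧ (I \ P).Nonempty then cumulantFun μ y I else 0

theorem mixedCumulant_congr_ae {y z : ι → Ω → ℂ} {P I : Finset ι} (h : ∀ i ∈ I, y i =ᵐ[μ] z i) :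
    mixedCumulant μ y P I = mixedCumulant μ z P I := by
  rw [mixedCumulant, mixedCumulant, cumulantFun, cumulantFun, cumulant_congr_ae h]

/-- The expectations `E[:y^{I ∩ P}: :y^{I \ P}:]`. -/
noncomputable def wickCross (μ : Measure Ω) (y : ι → Ω → ℂ) (P : Finset ι) : SetFunction ι ℂ :=
  expect μ (fun ω I => wick μ y (I ∩ P) ω * wick μ y (I \ P) ω)

theorem wickCross_congr_ae {y z : ι → Ω → ℂ} {P I : Finset ι} (h : ∀ i ∈ I, y i =ᵐ[μ] z i) :
    wickCross μ y P I = wickCross μ z P I :=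
  integral_congr_ae ((wick_congr_ae fun i hi => h i (Finset.inter_subset_left hi)).mul
    (wick_congr_ae fun i hi => h i (Finset.sdiff_subset hi)))

variable [Fintype ι] [IsProbabilityMeasure μ]

theorem mixedCumulant_eq (μ : Measure Ω) (y : ι → Ω → ℂ) (P : Finset ι) :
    mixedCumulant μ y P = cumulantFun μ y - restrict P (cumulantFun μ y) -
      restrict Pᶜ (cumulantFun μ y) := by
  ext I
  rcases I.eq_empty_or_nonempty with rfl | ⟨i, hi⟩
  · simp [mixedCumulant, restrict_apply, cumulantFun_empty]
  · have h1 : (I ∩ P).Nonempty ↔ ¬ I ⊆ Pᶜ := by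
      rw [← Finset.not_disjoint_iff_nonempty_inter, Finset.subset_compl_iff_disjoint_right]
    have h2 : (I \ P).Nonempty ↔ ¬ I ⊆ P := Finset.sdiff_nonempty
    have h3 : ¬ (I ⊆ P ∧ I ⊆ Pᶜ) := fun h => Finset.mem_compl.1 (h.2 hi) (h.1 hi)
    simp only [mixedCumulant, SetFunction.sub_apply, restrict_apply, h1, h2]
    by_cases h4 : I ⊆ P <;> by_cases h5 : I ⊆ Pᶜ <;> simp_all

theorem wickCross_eq {y : ι → Ω → ℂ} (hy : MomentsExist μ y Finset.univ) (P : Finset ι) :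
    wickCross μ y P * (restrict P (momentFun μ y) * restrict Pᶜ (momentFun μ y)) =
      momentFun μ y := by
  obtain ⟨c, hc, hw⟩ := exists_wickFun_eq μ y
  have hmon : ∀ ω, monomialFun y ω =
      restrict P (monomialFun y ω) * restrict Pᶜ (monomialFun y ω) := by
    intro ω
    ext I
    rw [restrict_mul_restrict_compl]
    simp only [monomialFun]
    rw [Finset.prod_inter_mul_prod_sdiff]
  have h1 : wickCross μ y P =
      expect μ (fun ω => monomialFun y ω * (restrict P c * restrict Pᶜ c)) := by
    refine congrArg (expect μ) (funext fun ω => ?_)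
    ext I
    rw [hmon ω, mul_mul_mul_comm, ← restrict_mul, ← restrict_mul, ← hw,
      restrict_mul_restrict_compl]
    rfl
  rw [h1, expect_mul hy.integrable, expect_monomialFun, mul_assoc, mul_mul_mul_comm,
    ← restrict_mul, ← restrict_mul, mul_comm c, hc]
  have h2 : restrict P (1 : SetFunction ι ℂ) * restrict Pᶜ (1 : SetFunction ι ℂ) = 1 := by
    ext I
    rw [restrict_mul_restrict_compl, one_apply, one_apply, one_apply]
    rcases I.eq_empty_or_nonempty with rfl | hI
    · simp
    · rw [if_neg hI.ne_empty]
      by_cases h : I ∩ P = ∅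
      · have : I \ P ≠ ∅ := by
          intro h'
          have := Finset.sdiff_union_inter I P
          rw [h, h'] at this
          simp at this
          exact hI.ne_empty this.symm
        simp [this]
      · simp [h]
  rw [h2, mul_one]

/-- In the moment-cumulant recursion for `E[:y^{I ∩ P}: :y^{I \ P}:]` only the mixed cumulants
appear. As power series, the expectations are `m / (m_P m_{Pᶜ})`, where `m_P` and `m_{Pᶜ}` have the
cumulants of the subsets of `P` and of `Pᶜ`. -/
theorem euler_wickCross {y : ι → Ω → ℂ} (hy : MomentsExist μ y Finset.univ) (P : Finset ι)
    (j : ι) :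
    euler j (wickCross μ y P) = euler j (mixedCumulant μ y P) * wickCross μ y P := by
  have h0 := wickCross_eq hy P
  have hm := euler_cumulantFun_mul μ y j
  have hP := congrArg (restrict P) hm
  have hQ := congrArg (restrict Pᶜ) hm
  rw [restrict_mul] at hP hQ
  have hd := congrArg (euler j) h0
  rw [euler_mul, euler_mul, euler_restrict, euler_restrict, ← hP, ← hQ, ← hm] at hd
  have hu : IsUnit (restrict P (momentFun μ y) * restrict Pᶜ (momentFun μ y)) := by
    refine isUnit_of_empty ?_
    rw [mul_empty, restrict_apply, restrict_apply]
    simp [momentFun_empty]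
  refine hu.mul_left_injective ?_
  simp only
  rw [mixedCumulant_eq, euler_sub, euler_sub, euler_restrict, euler_restrict]
  linear_combination hd - euler j (cumulantFun μ y) * h0

end Cross

end RandomField

/-! ### Discrete `ℓ_p` norms -/

section TsumNorm

variable {α β γ : Type*} {p : ℝ}

/-- The `ℓ_p` norm of a family of extended nonnegative reals. -/
noncomputable def tsumNorm (p : ℝ) (f : α → ℝ≥0∞) : ℝ≥0∞ := (∑' a, f a ^ p) ^ (1 / p)

theorem tsumNorm_mono (hp : 0 < p) {f g : α → ℝ≥0∞} (h : ∀ a, f a ≤ g a) :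
    tsumNorm p f ≤ tsumNorm p g :=
  ENNReal.rpow_le_rpow (ENNReal.tsum_le_tsum fun a => ENNReal.rpow_le_rpow (h a) hp.le)
    (by positivity)

theorem tsumNorm_comp_le (hp : 0 < p) {e : α → β} (he : Function.Injective e) (f : β → ℝ≥0∞) :
    tsumNorm p (fun a => f (e a)) ≤ tsumNorm p f :=
  ENNReal.rpow_le_rpow (ENNReal.tsum_comp_le_tsum_of_injective he fun b => f b ^ p)
    (by positivity)

theorem tsumNorm_zero (hp : 0 < p) : tsumNorm p (fun _ : α => 0) = 0 := by
  simp [tsumNorm, hp]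

theorem tsumNorm_of_unique (hp : 0 < p) [Unique α] (f : α → ℝ≥0∞) :
    tsumNorm p f = f default := by
  rw [tsumNorm, tsum_fintype, Fintype.sum_unique, ← ENNReal.rpow_mul, mul_one_div_cancel hp.ne',
    ENNReal.rpow_one]

theorem tsumNorm_add_le (hp : 1 ≤ p) (f g : α → ℝ≥0∞) :
    tsumNorm p (fun a => f a + g a) ≤ tsumNorm p f + tsumNorm p g := by
  let _ : MeasurableSpace α := ⊤
  have h := ENNReal.lintegral_Lp_add_le (μ := Measure.count) (f := f) (g := g)
    measurable_from_top.aemeasurable measurable_from_top.aemeasurable hp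
  simpa [lintegral_count, tsumNorm] using h

theorem tsumNorm_sum_le (hp : 1 ≤ p) (s : Finset β) (f : β → α → ℝ≥0∞) :
    tsumNorm p (fun a => ∑ b ∈ s, f b a) ≤ ∑ b ∈ s, tsumNorm p (f b) := by
  classical
  induction s using Finset.induction_on with
  | empty => simp [tsumNorm_zero (α := α) (zero_lt_one.trans_le hp)]
  | insert b s hb ih =>
    simp only [Finset.sum_insert hb]
    exact (tsumNorm_add_le hp _ _).trans (add_le_add_right ih _)

/-- The `ℓ_p` norm of a product of functions of separate variables; the index set may be smaller
than the product of the two index sets. -/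
theorem tsumNorm_mul_le (hp : 0 < p) {e : α → β} {e' : α → γ}
    (he : Function.Injective fun a => (e a, e' a)) (f : β → ℝ≥0∞) (g : γ → ℝ≥0∞) :
    tsumNorm p (fun a => f (e a) * g (e' a)) ≤ tsumNorm p f * tsumNorm p g := by
  refine (tsumNorm_comp_le hp he fun b : β × γ => f b.1 * g b.2).trans ?_
  rw [tsumNorm, tsumNorm, tsumNorm, ← ENNReal.mul_rpow_of_nonneg _ _ (by positivity)]
  refine ENNReal.rpow_le_rpow (le_of_eq ?_) (by positivity)
  rw [ENNReal.tsum_prod (f := fun b c => (f b * g c) ^ p), ← ENNReal.tsum_mul_right]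
  refine tsum_congr fun b => ?_
  rw [← ENNReal.tsum_mul_left]
  exact tsum_congr fun c => ENNReal.mul_rpow_of_nonneg _ _ hp.le

theorem tsum_mul_le_tsumNorm_two (f g : α → ℝ≥0∞) :
    ∑' a, f a * g a ≤ tsumNorm 2 f * tsumNorm 2 g := by
  let _ : MeasurableSpace α := ⊤
  have h := ENNReal.lintegral_mul_le_Lp_mul_Lq (μ := Measure.count) (p := 2) (q := 2)
    (by constructor <;> norm_num) (f := f) (g := g)
    measurable_from_top.aemeasurable measurable_from_top.aemeasurable
  simpa [lintegral_count, tsumNorm] using h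

end TsumNorm

/-- The induction step of the bound `∑_π ∏_{A ∈ π} |A|! ≤ n! c ^ n` for the sum over the set
partitions of an `n`-element set: the sum is over the block `S` that contains a given label `j`. -/
theorem sum_factorial_mul_factorial_le {ι : Type*} [DecidableEq ι] {U : Finset ι} {j : ι}
    (hj : j ∈ U) {c : ℝ≥0∞} (hc : ∀ k : ℕ, (k : ℝ≥0∞) ≤ c ^ k) (M : ℝ≥0∞) :
    ∑ S ∈ U.powerset with j ∈ S, (S.card.factorial * M ^ S.card) *
      ((U \ S).card.factorial * (c * M) ^ (U \ S).card) ≤ U.card.factorial * (c * M) ^ U.card := by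
  obtain ⟨N, hN⟩ : ∃ N, (U.erase j).card = N := ⟨_, rfl⟩
  have hU : U.card = N + 1 := by
    rw [← hN, Finset.card_erase_of_mem hj]
    have := Finset.card_pos.2 ⟨j, hj⟩
    omega
  set F : ℕ → ℝ≥0∞ := fun k => ((k + 1).factorial * M ^ (k + 1)) *
    ((N - k).factorial * (c * M) ^ (N - k)) with hF
  have h1 : ∑ S ∈ U.powerset with j ∈ S, ((S.card.factorial : ℝ≥0∞) * M ^ S.card) *
      ((U \ S).card.factorial * (c * M) ^ (U \ S).card) =
      ∑ S ∈ (U.erase j).powerset, F S.card := by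
    symm
    refine Finset.sum_nbij' (fun S => insert j S) (fun S => S.erase j) ?_ ?_ ?_ ?_ ?_
    · intro S hS
      rw [Finset.mem_powerset] at hS
      refine Finset.mem_filter.2 ⟨Finset.mem_powerset.2 ?_, Finset.mem_insert_self _ _⟩
      exact Finset.insert_subset hj (hS.trans (Finset.erase_subset _ _))
    · intro S hS
      rw [Finset.mem_filter, Finset.mem_powerset] at hS
      exact Finset.mem_powerset.2 (Finset.erase_subset_erase _ hS.1)
    · intro S hS
      rw [Finset.mem_powerset] at hS
      exact Finset.erase_insert fun h => (Finset.mem_erase.1 (hS h)).1 rfl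
    · intro S hS
      exact Finset.insert_erase (Finset.mem_filter.1 hS).2
    · intro S hS
      rw [Finset.mem_powerset] at hS
      have h2 : j ∉ S := fun h => (Finset.mem_erase.1 (hS h)).1 rfl
      have h3 : insert j S ⊆ U := Finset.insert_subset hj (hS.trans (Finset.erase_subset _ _))
      rw [Finset.card_sdiff_of_subset h3, Finset.card_insert_of_notMem h2, hU,
        Nat.add_sub_add_right]
  rw [h1, Finset.sum_powerset_apply_card, hN, hU]
  have h4 : ∀ k ∈ Finset.range (N + 1), N.choose k • F k ≤ N.factorial * (c * M) ^ (N + 1) := by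
    intro k hk
    have hk' : k ≤ N := Nat.lt_succ_iff.1 (Finset.mem_range.1 hk)
    have h5 : N.choose k * (k + 1).factorial * (N - k).factorial = N.factorial * (k + 1) := by
      rw [← Nat.choose_mul_factorial_mul_factorial hk', Nat.factorial_succ]
      ring
    have h6 : N.choose k • F k = N.factorial * (k + 1 : ℕ) * (c ^ (N - k) * M ^ (N + 1)) := by
      have : M ^ (N + 1) = M ^ (k + 1) * M ^ (N - k) := by
        rw [← pow_add]
        congr 1
        omega
      rw [← Nat.cast_mul, ← h5, this, nsmul_eq_mul]
      simp only [hF, mul_pow]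
      push_cast
      ring
    have h7 : (c * M) ^ (N + 1) = c ^ (k + 1) * (c ^ (N - k) * M ^ (N + 1)) := by
      rw [← mul_assoc, ← pow_add, mul_pow]
      congr 2
      omega
    rw [h6, h7, mul_assoc]
    gcongr
    exact hc _
  refine (Finset.sum_le_sum h4).trans (le_of_eq ?_)
  rw [Finset.sum_const, Finset.card_range, nsmul_eq_mul, Nat.factorial_succ]
  push_cast
  ring

/-! ### The norm of the expectations of products of two Wick polynomials -/

namespace RandomField

open SetFunction

variable {Ω ι Z : Type*}

/-- The label sequences that agree with `z₀` outside `A`. -/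
abbrev Fiber (z₀ : ι → Z) (A : Finset ι) := {z : ι → Z // ∀ i, i ∉ A → z i = z₀ i}

/-- The element of the fiber over a smaller set with the given values on that set. -/
def Fiber.restrict [DecidableEq ι] {z₀ : ι → Z} {A : Finset ι} (B : Finset ι) (z : Fiber z₀ A) :
    Fiber z₀ B :=
  ⟨B.piecewise z.1 z₀, fun _ hi => Finset.piecewise_eq_of_notMem _ _ _ hi⟩

variable [MeasurableSpace Ω] [LinearOrder ι] {μ : Measure Ω} [IsProbabilityMeasure μ]
  {φ : Z → Ω → ℂ} {p : ℝ}

theorem tsumNorm_mixedCumulant_le (hp : 0 < p) (P S : Finset ι) (z₀ : ι → Z) :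
    tsumNorm p (fun z : Fiber z₀ (S \ P) => ‖mixedCumulant μ (fun i => φ (z.1 i)) P S‖ₑ) ≤
      clusteringNorm μ φ p S.card := by
  by_cases hS : (S ∩ P).Nonempty ∧ (S \ P).Nonempty
  swap
  · simp [mixedCumulant, hS, tsumNorm_zero (α := Fiber z₀ (S \ P)) hp]
  obtain ⟨i₀, hi₀⟩ := hS.1
  rw [Finset.mem_inter] at hi₀
  obtain ⟨k, hk⟩ : ∃ k, S.card = k + 1 :=
    Nat.exists_eq_succ_of_ne_zero (Finset.card_pos.2 ⟨i₀, hi₀.1⟩).ne'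
  -- an enumeration of `S` starting at `i₀`; as `i₀ ∈ P`, all `z` in the fiber have `z i₀ = z₀ i₀`
  set q : Fin (k + 1) ≃ S := (S.equivFinOfCardEq hk).symm with hq
  set r : Fin (k + 1) ≃ S := (Equiv.swap 0 (q.symm ⟨i₀, hi₀.1⟩)).trans q with hr
  set e : Fin (k + 1) ↪ ι := r.toEmbedding.trans (Function.Embedding.subtype _) with he
  have he0 : e 0 = i₀ := by simp [he, hr]
  have heS : Finset.univ.map e = S := by
    ext i
    simp only [Finset.mem_map, Finset.mem_univ, true_and]
    constructor
    · rintro ⟨a, rfl⟩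
      exact (r a).2
    · intro hi
      exact ⟨r.symm ⟨i, hi⟩, by simp [he]⟩
  rw [hk, clusteringNorm]
  refine le_trans ?_ (le_iSup _ (z₀ i₀))
  have hval : ∀ z : Fiber z₀ (S \ P), mixedCumulant μ (fun i => φ (z.1 i)) P S =
      kappa μ (fun i => φ (Matrix.vecCons (z₀ i₀) (fun a : Fin k => z.1 (e a.succ)) i)) := by
    intro z
    have h1 : (fun i => φ (Matrix.vecCons (z₀ i₀) (fun a : Fin k => z.1 (e a.succ)) i)) =
        fun i => φ (z.1 (e i)) := by
      funext i
      refine Fin.cases ?_ (fun a => ?_) i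
      · rw [Matrix.cons_val_zero, he0, z.2 i₀ fun h => (Finset.mem_sdiff.1 h).2 hi₀.2]
      · rw [Matrix.cons_val_succ]
    rw [h1, mixedCumulant, if_pos hS]
    have h2 := congrFun (pullback_cumulantFun (μ := μ) e (fun i => φ (z.1 i))) Finset.univ
    rw [pullback_apply, heS] at h2
    exact h2
  simp only [hval]
  refine tsumNorm_comp_le hp (e := fun (z : Fiber z₀ (S \ P)) (a : Fin k) => z.1 (e a.succ)) ?_
    fun x => ‖kappa μ (fun i => φ (Matrix.vecCons (z₀ i₀) x i))‖ₑ
  intro z z' h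
  refine Subtype.ext (funext fun i => ?_)
  by_cases hi : i ∈ S \ P
  · obtain ⟨a, rfl⟩ : ∃ a, e a = i := by
      have := (Finset.mem_sdiff.1 hi).1
      rw [← heS] at this
      simpa using this
    have ha : a ≠ 0 := by
      rintro rfl
      rw [he0] at hi
      exact (Finset.mem_sdiff.1 hi).2 hi₀.2
    obtain ⟨b, rfl⟩ := Fin.exists_succ_eq.2 ha
    exact congrFun h b
  · rw [z.2 i hi, z'.2 i hi]

variable [Fintype ι]

/-- The `ℓ_p` norm of `E[:y^{U ∩ P}: :y^{U \ P}:]` as a function of the labels of `U \ P`, by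
induction on `U`: every block of the recursion is mixed, so the sum over its labels outside `P` is
bounded by the clustering norm. -/
theorem tsumNorm_wickCross_le (hp : 1 ≤ p) {c M : ℝ≥0∞} (hc : ∀ k : ℕ, (k : ℝ≥0∞) ≤ c ^ k)
    (hM : ∀ k, 1 ≤ k → k ≤ Fintype.card ι → clusteringNorm μ φ p k ≤ k.factorial * M ^ k)
    (hφ : ∀ z : ι → Z, MomentsExist μ (fun i => φ (z i)) Finset.univ)
    (P : Finset ι) (z₀ : ι → Z) (U : Finset ι) :
    tsumNorm p (fun z : Fiber z₀ (U \ P) => ‖wickCross μ (fun i => φ (z.1 i)) P U‖ₑ) ≤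
      U.card.factorial * (c * M) ^ U.card := by
  have hp0 : 0 < p := zero_lt_one.trans_le hp
  induction U using Finset.strongInduction with
  | H U ih =>
  rcases U.eq_empty_or_nonempty with rfl | ⟨j, hj⟩
  · let _ : Unique (Fiber z₀ (∅ \ P)) :=
      { default := ⟨z₀, fun _ _ => rfl⟩
        uniq := fun z => Subtype.ext (funext fun i => z.2 i (by simp)) }
    rw [tsumNorm_of_unique hp0]
    simp [wickCross, expect, wick_empty]
  · have hrec : ∀ z : Fiber z₀ (U \ P), wickCross μ (fun i => φ (z.1 i)) P U =
        ∑ S ∈ U.powerset with j ∈ S, mixedCumulant μ (fun i => φ (z.1 i)) P S *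
          wickCross μ (fun i => φ (z.1 i)) P (U \ S) := by
      intro z
      have h := congrFun (euler_wickCross (hφ z.1) P j) U
      rw [euler_apply, if_pos hj, mul_apply] at h
      rw [h, Finset.sum_filter]
      refine Finset.sum_congr rfl fun S _ => ?_
      rw [euler_apply]
      split_ifs <;> simp
    have hfac : ∀ S ∈ U.powerset.filter (j ∈ ·), tsumNorm p (fun z : Fiber z₀ (U \ P) =>
        ‖mixedCumulant μ (fun i => φ (z.1 i)) P S‖ₑ *
          ‖wickCross μ (fun i => φ (z.1 i)) P (U \ S)‖ₑ) ≤
        (S.card.factorial * M ^ S.card) *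
          ((U \ S).card.factorial * (c * M) ^ (U \ S).card) := by
      intro S hS
      rw [Finset.mem_filter, Finset.mem_powerset] at hS
      have hagree : ∀ (V : Finset ι), V ⊆ U → ∀ (z : Fiber z₀ (U \ P)), ∀ i ∈ V,
          (z.restrict (V \ P)).1 i = z.1 i := by
        intro V hV z i hi
        by_cases hiP : i ∈ P
        · rw [z.2 i (by simp [hiP]), (z.restrict (V \ P)).2 i (by simp [hiP])]
        · exact Finset.piecewise_eq_of_mem _ _ _ (Finset.mem_sdiff.2 ⟨hi, hiP⟩)
      have h1 : ∀ z : Fiber z₀ (U \ P), mixedCumulant μ (fun i => φ (z.1 i)) P S =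
          mixedCumulant μ (fun i => φ ((z.restrict (S \ P)).1 i)) P S := by
        intro z
        refine mixedCumulant_congr_ae fun i hi => ?_
        rw [hagree S hS.1 z i hi]
      have h2 : ∀ z : Fiber z₀ (U \ P), wickCross μ (fun i => φ (z.1 i)) P (U \ S) =
          wickCross μ (fun i => φ ((z.restrict ((U \ S) \ P)).1 i)) P (U \ S) := by
        intro z
        refine wickCross_congr_ae fun i hi => ?_
        rw [hagree (U \ S) Finset.sdiff_subset z i hi]
      simp only [h1, h2]
      refine (tsumNorm_mul_le hp0 (e := fun z : Fiber z₀ (U \ P) => z.restrict (S \ P))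
        (e' := fun z : Fiber z₀ (U \ P) => z.restrict ((U \ S) \ P)) ?_
        (fun z => ‖mixedCumulant μ (fun i => φ (z.1 i)) P S‖ₑ)
        (fun z => ‖wickCross μ (fun i => φ (z.1 i)) P (U \ S)‖ₑ)).trans ?_
      · intro z z' h
        simp only [Prod.mk.injEq] at h
        refine Subtype.ext (funext fun i => ?_)
        by_cases hi : i ∈ U
        · by_cases hiS : i ∈ S
          · rw [← hagree S hS.1 z i hiS, ← hagree S hS.1 z' i hiS, h.1]
          · have hi' := Finset.mem_sdiff.2 ⟨hi, hiS⟩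
            rw [← hagree _ Finset.sdiff_subset z i hi', ← hagree _ Finset.sdiff_subset z' i hi',
              h.2]
        · rw [z.2 i (by simp [hi]), z'.2 i (by simp [hi])]
      · refine mul_le_mul' ((tsumNorm_mixedCumulant_le hp0 P S z₀).trans ?_)
          (ih _ (Finset.sdiff_ssubset hS.1 ⟨j, hS.2⟩))
        exact hM _ (Finset.card_pos.2 ⟨j, hS.2⟩) (Finset.card_le_univ S)
    refine le_trans ?_ (sum_factorial_mul_factorial_le hj hc M)
    refine le_trans ?_ (Finset.sum_le_sum hfac)
    refine le_trans ?_ (tsumNorm_sum_le hp _ _)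
    refine tsumNorm_mono hp0 fun z => ?_
    rw [hrec]
    refine (enorm_sum_le _ _).trans (le_of_eq ?_)
    exact Finset.sum_congr rfl fun S _ => enorm_mul _ _

end RandomField

/-! ### A weighted Bessel inequality -/

section Bessel

variable {H α : Type*} [NormedAddCommGroup H] [InnerProductSpace ℂ H]

theorem sum_mul_norm_inner_sq_le {a : α → ℝ} (ha : ∀ x, 0 ≤ a x) (u : H) (v : α → H)
    (s : Finset α) {C : ℝ} (hC0 : 0 ≤ C)
    (hC : ∀ x ∈ s, ∑ y ∈ s, a y * ‖inner ℂ (v x) (v y)‖ ≤ C) :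
    ∑ x ∈ s, a x * ‖inner ℂ u (v x)‖ ^ 2 ≤ ‖u‖ ^ 2 * C := by
  set k : α → ℂ := fun x => inner ℂ u (v x) with hk
  set S := ∑ x ∈ s, a x * ‖k x‖ ^ 2 with hS
  have hS0 : 0 ≤ S := Finset.sum_nonneg fun x _ => mul_nonneg (ha x) (sq_nonneg _)
  -- testing `u` against `V` reproduces the sum to be estimated
  set V : H := ∑ x ∈ s, ((a x : ℂ) * conj (k x)) • v x with hV
  have hSV : S ≤ ‖u‖ * ‖V‖ := by
    have h1 : inner ℂ u V = (S : ℂ) := by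
      rw [hV, inner_sum, hS, Complex.ofReal_sum]
      refine Finset.sum_congr rfl fun x _ => ?_
      rw [inner_smul_right]
      change (a x : ℂ) * conj (k x) * k x = _
      rw [mul_assoc, Complex.conj_mul']
      push_cast
      rfl
    have h2 := norm_inner_le_norm (𝕜 := ℂ) u V
    rwa [h1, Complex.norm_real, Real.norm_of_nonneg hS0] at h2
  set g : α → α → ℝ := fun x y => ‖inner ℂ (v x) (v y)‖ with hg
  have hsymm : ∀ x y, g x y = g y x := fun x y => norm_inner_symm _ _
  have hg0 : ∀ x y, 0 ≤ g x y := fun x y => norm_nonneg _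
  have hVV : ‖V‖ ^ 2 ≤ S * C := by
    have h1 : ‖V‖ ^ 2 ≤ ∑ x ∈ s, ∑ y ∈ s, (a x * ‖k x‖) * (a y * ‖k y‖) * g x y := by
      have h2 : ‖V‖ ^ 2 = ‖inner ℂ V V‖ := by
        rw [inner_self_eq_norm_sq_to_K]
        simp
      rw [h2, hV, sum_inner]
      refine (norm_sum_le _ _).trans (Finset.sum_le_sum fun x _ => ?_)
      rw [inner_sum]
      refine (norm_sum_le _ _).trans (Finset.sum_le_sum fun y _ => le_of_eq ?_)
      rw [inner_smul_left, inner_smul_right, norm_mul, norm_mul, RCLike.norm_conj, norm_mul,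
        norm_mul, RCLike.norm_conj, RCLike.norm_conj, Complex.norm_real, Complex.norm_real,
        Real.norm_of_nonneg (ha x), Real.norm_of_nonneg (ha y)]
      simp only [hg]
      ring
    have h3 : ∑ x ∈ s, ∑ y ∈ s, (a x * ‖k x‖) * (a y * ‖k y‖) * g x y ≤
        ∑ x ∈ s, ∑ y ∈ s, ((a x * ‖k x‖ ^ 2) * (a y * g x y) / 2 +
          (a y * ‖k y‖ ^ 2) * (a x * g y x) / 2) := by
      refine Finset.sum_le_sum fun x _ => Finset.sum_le_sum fun y _ => ?_
      rw [hsymm y x]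
      have h4 : 0 ≤ a x * a y * g x y := mul_nonneg (mul_nonneg (ha x) (ha y)) (hg0 x y)
      nlinarith [mul_nonneg h4 (sq_nonneg (‖k x‖ - ‖k y‖))]
    have h5 : ∑ x ∈ s, ∑ y ∈ s, (a x * ‖k x‖ ^ 2) * (a y * g x y) / 2 ≤ S * C / 2 := by
      rw [hS, Finset.sum_mul, Finset.sum_div]
      refine Finset.sum_le_sum fun x hx => ?_
      rw [← Finset.sum_div, ← Finset.mul_sum]
      have := mul_le_mul_of_nonneg_left (hC x hx) (mul_nonneg (ha x) (sq_nonneg ‖k x‖))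
      linarith
    have h6 : ∑ x ∈ s, ∑ y ∈ s, (a y * ‖k y‖ ^ 2) * (a x * g y x) / 2 ≤ S * C / 2 := by
      rw [Finset.sum_comm]
      exact h5
    refine h1.trans (h3.trans ?_)
    simp only [Finset.sum_add_distrib]
    linarith
  rcases hS0.eq_or_lt with h0 | h0
  · rw [← h0]
    positivity
  · refine le_of_mul_le_mul_left ?_ h0
    calc S * S ≤ (‖u‖ * ‖V‖) * (‖u‖ * ‖V‖) := mul_self_le_mul_self hS0 hSV
      _ = ‖u‖ ^ 2 * ‖V‖ ^ 2 := by ring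
      _ ≤ ‖u‖ ^ 2 * (S * C) := mul_le_mul_of_nonneg_left hVV (sq_nonneg _)
      _ = S * (‖u‖ ^ 2 * C) := by ring

/-- A weighted Bessel inequality: the `a`-weighted square sum of the coefficients of `u` along the
vectors `v x` is bounded by the largest `a`-weighted row sum of the Gram matrix of the `v x`. -/
theorem tsum_mul_enorm_inner_sq_le (a : α → ℂ) (u : H) (v : α → H) {C : ℝ≥0∞} (hC' : C ≠ ∞)
    (hC : ∀ x, ∑' y, ‖a y‖ₑ * ‖inner ℂ (v x) (v y)‖ₑ ≤ C) :
    ∑' x, ‖a x‖ₑ * ‖inner ℂ u (v x)‖ₑ ^ 2 ≤ ENNReal.ofReal (‖u‖ ^ 2) * C := by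
  lift C to NNReal using hC'
  rw [ENNReal.tsum_eq_iSup_sum]
  refine iSup_le fun s => ?_
  have h1 : ∀ x ∈ s, ∑ y ∈ s, ‖a y‖ * ‖inner ℂ (v x) (v y)‖ ≤ (C : ℝ) := by
    intro x _
    have h2 := (ENNReal.sum_le_tsum s).trans (hC x)
    have h3 : ∑ y ∈ s, ‖a y‖ₑ * ‖inner ℂ (v x) (v y)‖ₑ =
        ENNReal.ofReal (∑ y ∈ s, ‖a y‖ * ‖inner ℂ (v x) (v y)‖) := by
      rw [ENNReal.ofReal_sum_of_nonneg fun y _ => by positivity]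
      refine Finset.sum_congr rfl fun y _ => ?_
      rw [ENNReal.ofReal_mul (norm_nonneg _), ofReal_norm, ofReal_norm]
    rw [h3, ENNReal.ofReal_le_iff_le_toReal ENNReal.coe_ne_top] at h2
    exact h2
  have h4 := sum_mul_norm_inner_sq_le (fun x => norm_nonneg (a x)) u v s C.2 h1
  have h5 : ∑ x ∈ s, ‖a x‖ₑ * ‖inner ℂ u (v x)‖ₑ ^ 2 =
      ENNReal.ofReal (∑ x ∈ s, ‖a x‖ * ‖inner ℂ u (v x)‖ ^ 2) := by
    rw [ENNReal.ofReal_sum_of_nonneg fun y _ => by positivity]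
    refine Finset.sum_congr rfl fun y _ => ?_
    rw [ENNReal.ofReal_mul (norm_nonneg _), ENNReal.ofReal_pow (norm_nonneg _), ofReal_norm,
      ofReal_norm]
  rw [h5]
  refine (ENNReal.ofReal_le_ofReal h4).trans (le_of_eq ?_)
  rw [ENNReal.ofReal_mul (sq_nonneg _)]
  congr 1
  exact ENNReal.ofReal_coe_nnreal

end Bessel

namespace RandomField

open SetFunction

variable {Ω Z : Type*} [MeasurableSpace Ω] {μ : Measure Ω} {φ : Z → Ω → ℂ}

/-! ### The clustering constant -/

theorem clusteringNorm_le {p : ℝ} {m k : ℕ} (hk : 1 ≤ k) (hkm : k ≤ m) :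
    clusteringNorm μ φ p k ≤ k.factorial * ((Finset.Icc 1 m).sup
      (fun n => (clusteringNorm μ φ p n / (n.factorial : ℝ≥0∞)) ^ (1 / (n : ℝ)))) ^ k := by
  have h1 := Finset.le_sup (f := fun n : ℕ =>
    (clusteringNorm μ φ p n / (n.factorial : ℝ≥0∞)) ^ (1 / (n : ℝ)))
    (Finset.mem_Icc.2 ⟨hk, hkm⟩)
  have h2 := pow_le_pow_left₀ zero_le h1 k
  have hk0 : (k : ℝ) ≠ 0 := by positivity
  rw [← ENNReal.rpow_natCast, ← ENNReal.rpow_mul, one_div_mul_cancel hk0, ENNReal.rpow_one] at h2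
  rw [mul_comm]
  refine (ENNReal.div_le_iff_le_mul (Or.inl ?_) (Or.inl (ENNReal.natCast_ne_top _))).1 h2
  exact_mod_cast k.factorial_ne_zero

theorem IsClusteringUpTo.clusteringNorm_le {p : ℝ} {m m' k : ℕ} (h : IsClusteringUpTo μ φ p m')
    (hm : m ≤ m') (hk : 1 ≤ k) (hkm : k ≤ m) :
    clusteringNorm μ φ p k ≤
      k.factorial * ENNReal.ofReal (clusteringConst μ φ p m) ^ k := by
  rw [clusteringConst, ENNReal.ofReal_toReal]
  · exact RandomField.clusteringNorm_le hk hkm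
  · refine ((Finset.sup_lt_iff (by simp)).2 fun n hn => ?_).ne
    rw [Finset.mem_Icc] at hn
    refine ENNReal.rpow_lt_top_of_nonneg (by positivity) (ENNReal.div_lt_top ?_ ?_).ne
    · exact (h n hn.1 (hn.2.trans hm)).2.ne
    · exact_mod_cast n.factorial_ne_zero

theorem natCast_le_exp_pow (k : ℕ) : (k : ℝ≥0∞) ≤ ENNReal.ofReal (Real.exp 1) ^ k := by
  rw [← ENNReal.ofReal_pow (Real.exp_pos 1).le, ← Real.exp_nat_mul, mul_one,
    ← ENNReal.ofReal_natCast]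
  refine ENNReal.ofReal_le_ofReal ?_
  linarith [Real.add_one_le_exp (k : ℝ)]

/-! ### Square integrability -/

/-- A product of `n` fields is square integrable when the moments of order `2n` exist: its squared
modulus is a product of `2n` fields, as the field is closed under complex conjugation. -/
theorem memLp_prod {n : ℕ} (hφ : ∀ x, AEMeasurable (φ x) μ) (hconj : ClosedUnderConj μ φ)
    (hmom : ∀ z : Fin (n + n) → Z, MomentsExist μ (fun i => φ (z i)) Finset.univ)
    (x : Fin n → Z) (E : Finset (Fin n)) : MemLp (fun ω => ∏ i ∈ E, φ (x i) ω) 2 μ := by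
  choose c hc using hconj
  have hmeas : AEStronglyMeasurable (fun ω => ∏ i ∈ E, φ (x i) ω) μ :=
    (Finset.aemeasurable_fun_prod E fun i _ => hφ (x i)).aestronglyMeasurable
  rw [memLp_two_iff_integrable_sq_norm hmeas]
  have h1 := (hmom (Fin.append x (c ∘ x))).integrable
    (E.map (Fin.castAddEmb n) ∪ E.map (Fin.natAddEmb n))
  refine h1.norm.congr ?_
  have h2 : ∀ᵐ ω ∂μ, ∀ i ∈ E, conj (φ (x i) ω) = φ (c (x i)) ω :=
    (Filter.eventually_all_finset E).2 fun i _ => hc (x i)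
  filter_upwards [h2] with ω hω
  have h3 : Disjoint (E.map (Fin.castAddEmb n)) (E.map (Fin.natAddEmb n)) := by
    rw [Finset.disjoint_left]
    intro i hi hi'
    obtain ⟨a, _, rfl⟩ := Finset.mem_map.1 hi
    obtain ⟨b, _, hb⟩ := Finset.mem_map.1 hi'
    have := congrArg Fin.val hb
    simp at this
    omega
  simp only [monomialFun]
  rw [Finset.prod_union h3, Finset.prod_map, Finset.prod_map]
  simp only [Fin.castAddEmb_apply, Fin.natAddEmb_apply, Fin.append_left, Fin.append_right,
    Function.comp_apply]
  rw [← Finset.prod_congr rfl hω, ← map_prod, norm_mul, RCLike.norm_conj, sq]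

theorem inner_toLp {f g : Ω → ℂ} (hf : MemLp f 2 μ) (hg : MemLp g 2 μ) :
    inner ℂ (hf.toLp f) (hg.toLp g) = ∫ ω, conj (f ω) * g ω ∂μ := by
  rw [L2.inner_def]
  refine integral_congr_ae ?_
  filter_upwards [hf.coeFn_toLp, hg.coeFn_toLp] with ω h1 h2
  rw [h1, h2, RCLike.inner_apply, mul_comm]

theorem wickFieldConj_eq {n : ℕ} (x : Fin n → Z) (ω : Ω) :
    wickFieldConj μ φ x ω = conj (wickField μ φ x ω) :=
  conj_wick μ (fun i => φ (x i)) Finset.univ ω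

variable [IsProbabilityMeasure μ]

theorem memLp_wickField {n : ℕ} {x : Fin n → Z}
    (h : ∀ E : Finset (Fin n), MemLp (fun ω => ∏ i ∈ E, φ (x i) ω) 2 μ) :
    MemLp (wickField μ φ x) 2 μ := by
  obtain ⟨c, -, hw⟩ := exists_wickFun_eq μ (fun i => φ (x i))
  have h1 : wickField μ φ x = fun ω => ∑ E ∈ (Finset.univ : Finset (Fin n)).powerset,
      (∏ i ∈ E, φ (x i) ω) * c (Finset.univ \ E) :=
    funext fun ω => congrFun (hw ω) Finset.univ
  rw [h1]
  exact memLp_finsetSum _ fun E _ => (h E).mul_const _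

theorem momentsExist_joint {n : ℕ} {x : Fin n → Z} {X : Ω → ℂ} (hX : MemLp X 2 μ)
    (h : ∀ E : Finset (Fin n), MemLp (fun ω => ∏ i ∈ E, φ (x i) ω) 2 μ) :
    MomentsExist μ (joint X φ x) Finset.univ := by
  intro E _
  have h1 : ∀ ω, ∏ i ∈ E, joint X φ x i ω = (if 0 ∈ E then X ω else 1) *
      ∏ i ∈ Finset.univ.filter (fun i : Fin n => i.succ ∈ E), φ (x i) ω := by
    intro ω
    have h2 : ∏ i ∈ E, joint X φ x i ω = ∏ i, if i ∈ E then joint X φ x i ω else 1 := by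
      rw [Finset.prod_ite_mem, Finset.univ_inter]
    rw [h2, Fin.prod_univ_succ, Finset.prod_filter]
    rfl
  simp only [h1]
  by_cases h0 : 0 ∈ E
  · simp only [h0, if_true]
    exact hX.integrable_mul (h _)
  · simp only [h0, if_false, one_mul]
    exact (h _).integrable one_le_two

/-! ### Cumulants and Wick covariances as inner products -/

/-- `E[X X*]` for the centred random variable is the covariance. -/
theorem integral_norm_sub_sq_eq_cov {X : Ω → ℂ} (hX : MemLp X 2 μ) :
    ∫ ω, ‖X ω - ∫ ω', X ω' ∂μ‖ ^ 2 ∂μ = (cov μ (fun ω => conj (X ω)) X).re := by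
  set m := ∫ ω, X ω ∂μ with hm
  have hXi : Integrable X μ := hX.integrable one_le_two
  have hXc : MemLp (fun ω => conj (X ω)) 2 μ := hX.star
  have hXci : Integrable (fun ω => conj (X ω)) μ := hXc.integrable one_le_two
  have hXX : Integrable (fun ω => conj (X ω) * X ω) μ := hXc.integrable_mul hX
  have h1 : ∀ ω, ((‖X ω - m‖ ^ 2 : ℝ) : ℂ) =
      conj (X ω) * X ω - conj (X ω) * m - (conj m * X ω - conj m * m) := by
    intro ω
    rw [Complex.ofReal_pow, ← Complex.conj_mul', map_sub]
    ring
  have h2 : ((∫ ω, ‖X ω - m‖ ^ 2 ∂μ : ℝ) : ℂ) = cov μ (fun ω => conj (X ω)) X := by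
    rw [← integral_complex_ofReal]
    simp only [h1]
    have i1 : Integrable (fun ω => conj (X ω) * X ω - conj (X ω) * m) μ :=
      hXX.sub (hXci.mul_const _)
    have i2 : Integrable (fun ω => conj m * X ω - conj m * m) μ :=
      (hXi.const_mul _).sub (integrable_const _)
    rw [integral_sub i1 i2, integral_sub hXX (hXci.mul_const _),
      integral_sub (hXi.const_mul _) (integrable_const _),
      integral_mul_const, integral_const_mul, integral_conj, integral_const, cov, integral_conj]
    simp [← hm]
  rw [← h2, Complex.ofReal_re]

/-- The cumulants of `X` and the field are the coefficients of the centred `X` along the Wick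
polynomials; the centring is for free as Wick polynomials of positive degree have mean zero. -/
theorem kappa_joint_eq {n : ℕ} (hn : 1 ≤ n) {x : Fin n → Z} {X : Ω → ℂ} (hX : MemLp X 2 μ)
    (h : ∀ E : Finset (Fin n), MemLp (fun ω => ∏ i ∈ E, φ (x i) ω) 2 μ) :
    kappa μ (joint X φ x) = ∫ ω, (X ω - ∫ ω', X ω' ∂μ) * wickField μ φ x ω ∂μ := by
  have hw := memLp_wickField h
  have h1 : kappa μ (joint X φ x) = ∫ ω, X ω * wickField μ φ x ω ∂μ :=
    kappa_eq_integral_mul_wick _ (momentsExist_joint hX h)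
  have hmom : MomentsExist μ (fun i => φ (x i)) Finset.univ :=
    fun E _ => (h E).integrable one_le_two
  have h2 : ∫ ω, wickField μ φ x ω ∂μ = 0 := by
    have := congrFun (expect_wickFun hmom) Finset.univ
    rw [one_apply, if_neg] at this
    · exact this
    · have : Nonempty (Fin n) := ⟨⟨0, hn⟩⟩
      exact Finset.univ_nonempty.ne_empty
  have hXw : Integrable (fun ω => X ω * wickField μ φ x ω) μ := hX.integrable_mul hw
  simp only [sub_mul]
  rw [integral_sub hXw ((hw.integrable one_le_two).const_mul _),
    integral_const_mul, h2, mul_zero, sub_zero, h1]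

/-- The `ℓ_p` norm of `Φ_n(x', ·)`. -/
theorem tsumNorm_wickCov_le {n : ℕ} {p : ℝ} (hp : 1 ≤ p) (hconj : ClosedUnderConj μ φ)
    (hmom : ∀ z : Fin (n + n) → Z, MomentsExist μ (fun i => φ (z i)) Finset.univ)
    {c M : ℝ≥0∞} (hc : ∀ k : ℕ, (k : ℝ≥0∞) ≤ c ^ k)
    (hM : ∀ k, 1 ≤ k → k ≤ 2 * n → clusteringNorm μ φ p k ≤ k.factorial * M ^ k)
    (x' : Fin n → Z) :
    tsumNorm p (fun x : Fin n → Z => ‖wickCov μ φ x' x‖ₑ) ≤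
      (2 * n).factorial * (c * M) ^ (2 * n) := by
  choose s hs using hconj
  set P : Finset (Fin (n + n)) := Finset.univ.map (Fin.castAddEmb n) with hP
  have hPc : Finset.univ \ P = Finset.univ.map (Fin.natAddEmb n) := by
    ext i
    simp only [hP, Finset.mem_sdiff, Finset.mem_univ, true_and, Finset.mem_map]
    refine Fin.addCases (fun a => ?_) (fun a => ?_) i
    · simp [Fin.ext_iff]
      intro b
      omega
    · simp [Fin.ext_iff]
      intro b
      omega
  set z : (Fin n → Z) → Fin (n + n) → Z := fun x => Fin.append (s ∘ x') x with hz
  have hfib : ∀ x : Fin n → Z, ∀ i, i ∉ Finset.univ \ P → z x i = z x' i := by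
    intro x i hi
    rw [hPc] at hi
    refine Fin.addCases (fun a => ?_) (fun a ha => ?_) i (motive := fun i =>
      i ∉ Finset.univ.map (Fin.natAddEmb n) → z x i = z x' i) hi
    · simp [hz]
    · simp at ha
  have hcov : ∀ x, wickCov μ φ x' x =
      wickCross μ (fun i => φ (z x i)) P Finset.univ := by
    intro x
    refine integral_congr_ae ?_
    have h1 : wickFieldConj μ φ x' =ᵐ[μ] wick μ (fun i => φ (s (x' i))) Finset.univ :=
      wick_congr_ae fun i _ => hs (x' i)
    filter_upwards [h1] with ω hω
    have h2 := congrFun (pullback_wickFun (Fin.castAddEmb n) μ (fun i => φ (z x i)) ω) Finset.univ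
    have h3 := congrFun (pullback_wickFun (Fin.natAddEmb n) μ (fun i => φ (z x i)) ω) Finset.univ
    rw [pullback_apply] at h2 h3
    simp only [wickFun, hz, Fin.castAddEmb_apply, Fin.natAddEmb_apply, Fin.append_left,
      Fin.append_right, Function.comp_apply] at h2 h3
    rw [Finset.univ_inter, hPc, hω, wickField]
    simp only [hz, hP]
    rw [h2, h3]
  have key := tsumNorm_wickCross_le hp hc (by rwa [Fintype.card_fin, ← two_mul]) hmom P (z x')
    Finset.univ
  rw [show (Finset.univ : Finset (Fin (n + n))).card = 2 * n by simp [two_mul]] at key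
  simp only [hcov]
  refine le_trans ?_ key
  refine tsumNorm_comp_le (zero_lt_one.trans_le hp) (e := fun x => (⟨z x, hfib x⟩ :
    Fiber (z x') (Finset.univ \ P))) ?_
    (fun z : Fiber (z x') (Finset.univ \ P) => ‖wickCross μ (fun i => φ (z.1 i)) P Finset.univ‖ₑ)
  intro x y hxy
  have h := congrArg Subtype.val hxy
  funext i
  have := congrFun h (Fin.natAdd n i)
  simp only [hz] at this
  rwa [Fin.append_right, Fin.append_right] at this

/-- The weighted Bessel inequality for the coefficients `κ[X, φ(x_1), …, φ(x_n)]` of the centred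
`X` along the Wick polynomials, whose Gram matrix is `Φ_n`. -/
theorem tsum_mul_kappa_joint_sq_le {n : ℕ} (hn : 1 ≤ n) {X : Ω → ℂ} (hX : MemLp X 2 μ)
    (h : ∀ (x : Fin n → Z) (E : Finset (Fin n)), MemLp (fun ω => ∏ i ∈ E, φ (x i) ω) 2 μ)
    (a : (Fin n → Z) → ℂ) {C : ℝ} (hC0 : 0 ≤ C)
    (hC : ∀ x', ∑' x, ‖a x‖ₑ * ‖wickCov μ φ x' x‖ₑ ≤ ENNReal.ofReal C) :
    (∑' x, ‖a x‖ₑ * ‖kappa μ (joint X φ x)‖ₑ ^ 2) ^ (1 / 2 : ℝ) ≤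
      ENNReal.ofReal (√(cov μ (fun ω => conj (X ω)) X).re * √C) := by
  have hY : MemLp (fun ω => X ω - ∫ ω', X ω' ∂μ) 2 μ := hX.sub (memLp_const _)
  have hYc : MemLp (fun ω => conj (X ω - ∫ ω', X ω' ∂μ)) 2 μ := hY.star
  set u := hYc.toLp _ with hu
  set v := fun x : Fin n → Z => (memLp_wickField (h x)).toLp _ with hv
  have hκ : ∀ x, kappa μ (joint X φ x) = inner ℂ u (v x) := by
    intro x
    rw [hu, hv, inner_toLp, kappa_joint_eq hn hX (h x)]
    simp only [Complex.conj_conj]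
  have hΦ : ∀ x' x, wickCov μ φ x' x = inner ℂ (v x') (v x) := by
    intro x' x
    rw [hv, inner_toLp, wickCov]
    simp only [wickFieldConj_eq]
  have hnorm : ‖u‖ ^ 2 = (cov μ (fun ω => conj (X ω)) X).re := by
    have h1 : inner ℂ u u = ((∫ ω, ‖X ω - ∫ ω', X ω' ∂μ‖ ^ 2 ∂μ : ℝ) : ℂ) := by
      rw [hu, inner_toLp, ← integral_complex_ofReal]
      refine integral_congr_ae (Filter.Eventually.of_forall fun ω => ?_)
      simp only
      rw [Complex.conj_mul', RCLike.norm_conj, Complex.ofReal_pow]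
    rw [inner_self_eq_norm_sq_to_K] at h1
    rw [← integral_norm_sub_sq_eq_cov hX]
    exact Complex.ofReal_injective (by simpa using h1)
  simp only [hκ, hΦ] at hC ⊢
  have key := tsum_mul_enorm_inner_sq_le a u v ENNReal.ofReal_ne_top hC
  refine (ENNReal.rpow_le_rpow key (by norm_num)).trans (le_of_eq ?_)
  rw [← hnorm, ← ENNReal.ofReal_mul (sq_nonneg _), ENNReal.ofReal_rpow_of_nonneg (by positivity)
    (by norm_num), ← Real.sqrt_eq_rpow, Real.sqrt_mul (sq_nonneg _)]

end RandomField

theorem theorem3 {Ω : Type*} [MeasurableSpace Ω] {Z : Type*} [Countable Z]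
    (μ : Measure Ω) [IsProbabilityMeasure μ]
    (φ : Z → Ω → ℂ) (hφ : ∀ x, AEMeasurable (φ x) μ) (hconj : ClosedUnderConj μ φ)
    (N : ℕ) (hN : 1 ≤ N) (X : Ω → ℂ) (hX : MemLp X 2 μ) :
    (IsClusteringUpTo μ φ 1 (2 * N) → ∀ n : ℕ, 1 ≤ n → n ≤ N →
      (∀ x : Fin n → Z, MomentsExist μ (joint X φ x) Finset.univ) ∧
      (∑' x : Fin n → Z, ‖kappa μ (joint X φ x)‖ₑ ^ 2) ^ (1 / 2 : ℝ) ≤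
        ENNReal.ofReal (√(cov μ (fun ω => conj (X ω)) X).re *
          clusteringConst μ φ 1 (2 * n) ^ n * Real.exp 1 ^ n *
          √((2 * n).factorial : ℝ))) ∧
    (IsClusteringUpTo μ φ 2 (2 * N) → ∀ n : ℕ, 1 ≤ n → n ≤ N →
      (∀ x : Fin n → Z, MomentsExist μ (joint X φ x) Finset.univ) ∧
      (∀ x' x : Fin n → Z,
        Integrable (fun ω => wickFieldConj μ φ x' ω * wickField μ φ x ω) μ) ∧
      (⨆ x' : Fin n → Z, (∑' x : Fin n → Z,
          ‖wickCov μ φ x' x‖ₑ * ‖kappa μ (joint X φ x)‖ₑ ^ 2) ^ (1 / 2 : ℝ)) ≤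
        ENNReal.ofReal (√(cov μ (fun ω => conj (X ω)) X).re *
          clusteringConst μ φ 2 (2 * n) ^ (2 * n) * Real.exp 1 ^ (2 * n) *
          ((2 * n).factorial : ℝ))) := by

  have hmom : ∀ p, IsClusteringUpTo μ φ p (2 * N) → ∀ n, 1 ≤ n → n ≤ N →
      ∀ z : Fin (n + n) → Z, MomentsExist μ (fun i => φ (z i)) Finset.univ :=
    fun p h n hn hnN => (h (n + n) (by omega) (by omega)).1
  have hrow : ∀ p, 1 ≤ p → IsClusteringUpTo μ φ p (2 * N) → ∀ n, 1 ≤ n → n ≤ N →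
      ∀ x' : Fin n → Z, tsumNorm p (fun x : Fin n → Z => ‖wickCov μ φ x' x‖ₑ) ≤
        ENNReal.ofReal ((2 * n).factorial *
          (Real.exp 1 * clusteringConst μ φ p (2 * n)) ^ (2 * n)) := by
    intro p hp h n hn hnN x'
    have hM : 0 ≤ clusteringConst μ φ p (2 * n) := ENNReal.toReal_nonneg
    refine (tsumNorm_wickCov_le hp hconj (hmom p h n hn hnN) natCast_le_exp_pow
      (fun k hk hkn => h.clusteringNorm_le (by omega) hk hkn) x').trans (le_of_eq ?_)
    rw [← ENNReal.ofReal_mul (Real.exp_pos 1).le, ← ENNReal.ofReal_pow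
      (mul_nonneg (Real.exp_pos 1).le hM), ENNReal.ofReal_mul (by positivity),
      ENNReal.ofReal_natCast]
  constructor
  · intro h n hn hnN
    have hL := memLp_prod hφ hconj (hmom 1 h n hn hnN)
    refine ⟨fun x => momentsExist_joint hX (hL x), ?_⟩
    have hM : 0 ≤ clusteringConst μ φ 1 (2 * n) := ENNReal.toReal_nonneg
    set M := clusteringConst μ φ 1 (2 * n)
    have key := tsum_mul_kappa_joint_sq_le hn hX hL (fun _ => 1)
      (C := (2 * n).factorial * (Real.exp 1 * M) ^ (2 * n)) (by positivity) fun x' => by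
        simpa [tsumNorm] using hrow 1 le_rfl h n hn hnN x'
    simp only [enorm_one, one_mul] at key
    refine key.trans (le_of_eq (congrArg ENNReal.ofReal ?_))
    rw [Real.sqrt_mul (by positivity), mul_comm 2 n, pow_mul, Real.sqrt_sq (by positivity), mul_pow]
    ring
  · intro h n hn hnN
    have hL := memLp_prod hφ hconj (hmom 2 h n hn hnN)
    refine ⟨fun x => momentsExist_joint hX (hL x), fun x' x => ?_, iSup_le fun x' => ?_⟩
    · have h1 : MemLp (wickFieldConj μ φ x') 2 μ := by
        rw [funext (wickFieldConj_eq x')]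
        exact (memLp_wickField (hL x')).star
      exact h1.integrable_mul (memLp_wickField (hL x))
    · have hM : 0 ≤ clusteringConst μ φ 2 (2 * n) := ENNReal.toReal_nonneg
      have hrow' := hrow 2 one_le_two h n hn hnN
      set M := clusteringConst μ φ 2 (2 * n)
      set B := ((2 * n).factorial : ℝ) * (Real.exp 1 * M) ^ (2 * n) with hB
      have hB0 : 0 ≤ B := by positivity
      -- the weight `|Φ_n(x', ·)|` turns the row sums into `ℓ_2` pairings of two rows of `Φ_n`
      have key := tsum_mul_kappa_joint_sq_le hn hX hL (wickCov μ φ x') (C := B ^ 2)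
        (sq_nonneg _) fun y => by
          refine (tsum_mul_le_tsumNorm_two _ _).trans ?_
          rw [sq, ENNReal.ofReal_mul hB0]
          exact mul_le_mul' (hrow' x') (hrow' y)
      refine key.trans (le_of_eq (congrArg ENNReal.ofReal ?_))
      rw [Real.sqrt_sq hB0, hB, mul_pow]
      ring
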